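/- Consider the Hilbert space $(\mathbb{C}^2)^{\otimes N}$ of $N$ qubits, and let $\|\cdot\|_\infty$ denote the operator norm. An operator is called $k$-local if it is a sum of operators each of which acts nontrivially on at most $k$ qubits. For a group $G$ of unitary operators write $\mathfrak{g}=\{X : e^{tX}\in G \text{ for all } t\in\mathbb{R}\}$ for its Lie algebra. A unit vector $|\psi\rangle$ is an $\epsilon$-approximate Nash state of observables $\hat h_1,\dots,\hat h_M$ and groups $G_1,\dots,G_M$ of unitary operators (with Lie algebras $\mathfrak{g}_i$) if for every $i$, every real basis $\hat A_{1},\dots,\hat A_{m}$ of $\mathfrak{g}_i$ with $\|\hat A_{\alpha}\|_\infty=1$ for all $\alpha$, and every $v\in\mathbb{R}^{m}$, $$\Big|\langle\psi|\big[\hat h_i,\textstyle\sum_\alpha v_\alpha \hat A_{\alpha}\big]|\psi\rangle\Big|\le \epsilon\sum_\alpha |v_\alpha| .$$ Let $k,c\in\mathbb{N}$ and $C,D\in\mathbb{R}$. Then there is an $N_0$, depending only on $k,c,C,D$, such that the following holds for every $N\ge N_0$ and every $M\le DN$. Let $\hat h_1,\dots,\hat h_M$ be $k$-local Hermitian operators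 on $N$ qubits with $\|\hat h_i\|_\infty\le C N^c$. For each $i$ let $\hat A_{i1},\dots,\hat A_{im_i}$ be $k$-local anti-Hermitian operators with $\|\hat A_{i\alpha}\|_\infty=1$, let $G_i$ be the group of unitary operators generated by all $e^{t\hat A_{i\alpha}}$, $t\in\mathbb{R}$, and suppose that $\hat A_{i1},\dots,\hat A_{im_i}$ is a real basis of the Lie algebra $\mathfrak{g}_i$ of $G_i$. (The groups $G_i$ may, but need not, commute pairwise.) Then a pure state $|\psi\rangle$ drawn uniformly (Haar) at random from the unit sphere of $(\mathbb{C}^2)^{\otimes N}$ is a $2^{-N/4}$-approximate Nash state of $\{\hat h_i\}_{i=1}^M$ and $\{G_i\}_{i=1}^M$ with probability at least $1-2^{-2^{N/4}}$. -/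

import Mathlib

open scoped Matrix Matrix.Norms.L2Operator

noncomputable section

namespace NashStates

/-- Labels `x ∈ {0,1}^N` of the computational basis of `N` qubits. -/
abbrev Bits (N : ℕ) : Type := Fin N → Fin 2

/-- The Hilbert space `(ℂ²)^{⊗ N} ≅ ℂ^(2^N)` of `N` qubits, in the computational basis. -/
abbrev Hilb (N : ℕ) : Type := EuclideanSpace ℂ (Bits N)

/-- Operators on `N` qubits, as matrices in the computational basis.
The norm `‖·‖` on them is the operator norm induced by the Hilbert space norm. -/
abbrev Op (N : ℕ) : Type := Matrix (Bits N) (Bits N) ℂ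

/-- The unitary operators on `N` qubits. -/
abbrev U (N : ℕ) : Type := Matrix.unitaryGroup (Bits N) ℂ

/-- Unit vectors representing the pure states of `N` qubits. -/
abbrev PureState (N : ℕ) : Type := Metric.sphere (0 : Hilb N) 1

/-- The law of a uniformly (Haar) random pure state: the surface measure of the unit sphere of the
Hilbert space, normalized to total mass one. -/
def uniformState (N : ℕ) : MeasureTheory.Measure (PureState N) :=
  ((MeasureTheory.volume : MeasureTheory.Measure (Hilb N)).toSphere Set.univ)⁻¹ •
    (MeasureTheory.volume : MeasureTheory.Measure (Hilb N)).toSphere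

/-- The expectation value `⟨ψ| O |ψ⟩`. -/
def expect {N : ℕ} (ψ : Hilb N) (O : Op N) : ℂ :=
  inner ℂ ψ (Matrix.toEuclideanCLM (n := Bits N) (𝕜 := ℂ) O ψ)

/-- `B` acts trivially outside the set `S` of qubits, that is, `B = b ⊗ 1` with `b` acting on the
qubits in `S`. -/
def ActsOn {N : ℕ} (S : Finset (Fin N)) (B : Op N) : Prop :=
  ∃ b : Matrix (S → Fin 2) (S → Fin 2) ℂ, ∀ x y : Bits N,
    B x y = if ∀ j, j ∉ S → x j = y j then b (fun j => x j) (fun j => y j) else 0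

/-- `O` is `k`-local: a sum of operators each of which acts nontrivially on at most `k` qubits. -/
def IsLocal {N : ℕ} (k : ℕ) (O : Op N) : Prop :=
  ∃ (r : ℕ) (B : Fin r → Op N),
    (∀ j, ∃ S : Finset (Fin N), S.card ≤ k ∧ ActsOn S (B j)) ∧ O = ∑ j, B j

/-- The group of unitaries generated by the one-parameter groups `t ↦ exp (t A_α)`. -/
def generatedGroup {N m : ℕ} (A : Fin m → Op N) : Subgroup (U N) :=
  Subgroup.closure {V : U N | ∃ (α : Fin m) (t : ℝ), (V : Op N) = NormedSpace.exp (t • A α)}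

/-- The Lie algebra of a group of unitaries: all `X` with `exp (t X) ∈ G` for every real `t`. -/
def lieAlg {N : ℕ} (G : Subgroup (U N)) : Set (Op N) :=
  {X | ∀ t : ℝ, ∃ V ∈ G, (V : Op N) = NormedSpace.exp (t • X)}

/-- `A` is a (real) basis of the Lie algebra of `G` consisting of operators of norm one. -/
def IsNormalizedBasis {N m : ℕ} (G : Subgroup (U N)) (A : Fin m → Op N) : Prop :=
  LinearIndependent ℝ A ∧ (Submodule.span ℝ (Set.range A) : Set (Op N)) = lieAlg G ∧
    ∀ α, ‖A α‖ = 1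

/-- `ψ` is an `ε`-approximate Nash state of the observables `h i` and the groups `G i`:
`|⟨ψ| [h i, v · A] |ψ⟩| ≤ ε ‖v‖₁` for all `i`, all normalized bases `A` of the Lie algebra of `G i`
and all real coefficient vectors `v`. -/
def IsApproxNash {N M : ℕ} (ε : ℝ) (h : Fin M → Op N) (G : Fin M → Subgroup (U N))
    (ψ : Hilb N) : Prop :=
  ∀ (i : Fin M) (m : ℕ) (A : Fin m → Op N), IsNormalizedBasis (G i) A →
    ∀ v : Fin m → ℝ, ‖expect ψ (h i * (∑ α, v α • A α) - (∑ α, v α • A α) * h i)‖ ≤ ε * ∑ α, |v α|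

end NashStates

end

/-!
A uniformly random pure state is a Nash state because one has to control only a polynomial
number of expectation values, each of which is concentrated around zero with a tail that is doubly
exponentially small in `N`.

*Reduction to Pauli strings.* An element `X` of the Lie algebra of `G i` is a real combination of
`k`-local operators, so its expansion in Pauli strings involves only strings of weight at most `k`
(`trace_pauli_mul_eq_zero_of_isLocal`), of which there are at most `(4 N + 1) ^ k`
(`card_lowWeight_le`). Its coefficients are normalized traces `tr (P X) / 2 ^ N`, bounded by `‖X‖`,
and `‖X‖` is at most the `ℓ¹` norm of the coordinates of `X` in any normalized basis. Hence the Nash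
condition for all bases follows from smallness of `⟨ψ| [h i, P] |ψ⟩` for the low-weight strings `P`
(`norm_expect_commutator_le`). Neither the conditioning of the bases nor a net enters.

*Concentration.* The operator `H = ± I [h i, P]` is Hermitian and traceless with `‖H‖ ≤ Λ`, where
`Λ` is polynomial in `N`. The normalized surface measure of a set of states is the fraction of the
unit ball filled by the cone over that set. If `⟨ψ|H|ψ⟩ ≥ δ` for all states of the set, this cone
lies in the ellipsoid `⟨x|T|x⟩ < 1` with `T = (1 + s δ) - s H`, whose volume is `1 / det T` times
that of the ball: if `T = Bᴴ B`, then the real Jacobian of `B` is `|det B| ^ 2 = det T`.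
As `H` is traceless, the first order of `log det T` is `2 ^ N s δ`; for `s` of order `δ / Λ ^ 2` the
second order is harmless and `det T ≥ exp (2 ^ N δ ^ 2 / (32 Λ ^ 2))`
(`posDef_and_exp_le_det`, `uniformState_expect_ge_le`).

With `δ` equal to `2 ^ (-N / 4)` up to a polynomial factor, the exponent is `2 ^ (N / 2)` up to a
polynomial factor, which beats both the union bound and the required `2 ^ (N / 4)`.
-/

noncomputable section

namespace NashStates

open MeasureTheory Filter
open scoped Pointwise

/-! ### Expectation values -/

lemma expect_add {N : ℕ} (ψ : Hilb N) (O P : Op N) :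
    expect ψ (O + P) = expect ψ O + expect ψ P := by
  simp [expect]

lemma expect_smul {N : ℕ} (ψ : Hilb N) (a : ℂ) (O : Op N) :
    expect ψ (a • O) = a * expect ψ O := by
  simp [expect]

lemma expect_neg {N : ℕ} (ψ : Hilb N) (O : Op N) : expect ψ (-O) = -expect ψ O := by
  simp [expect]

lemma expect_sum {N : ℕ} {ι : Type*} (s : Finset ι) (ψ : Hilb N) (O : ι → Op N) :
    expect ψ (∑ i ∈ s, O i) = ∑ i ∈ s, expect ψ (O i) := by
  simp [expect]

lemma expect_conjTranspose_mul_self {N : ℕ} (ψ : Hilb N) (B : Op N) :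
    expect ψ (Bᴴ * B) = (‖Matrix.toEuclideanCLM (n := Bits N) (𝕜 := ℂ) B ψ‖ ^ 2 : ℝ) := by
  rw [expect, map_mul, ← Matrix.star_eq_conjTranspose, map_star,
    ContinuousLinearMap.star_eq_adjoint, mul_apply_eq_comp,
    ContinuousLinearMap.adjoint_inner_right, inner_self_eq_norm_sq_to_K]
  simp

lemma expect_one {N : ℕ} (ψ : Hilb N) : expect ψ 1 = (‖ψ‖ ^ 2 : ℝ) := by
  simpa using expect_conjTranspose_mul_self ψ 1

lemma expect_real_smul_left {N : ℕ} (r : ℝ) (ψ : Hilb N) (O : Op N) :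
    expect (r • ψ) O = (r ^ 2 : ℝ) * expect ψ O := by
  have h : (r • ψ : Hilb N) = (r : ℂ) • ψ := (RCLike.real_smul_eq_coe_smul (K := ℂ) r ψ)
  rw [h, expect, map_smul, inner_smul_left, inner_smul_right, expect]
  simp
  ring

lemma continuous_expect {N : ℕ} (O : Op N) : Continuous fun ψ : Hilb N => expect ψ O := by
  unfold expect
  fun_prop

lemma expect_im_of_isHermitian {N : ℕ} (ψ : Hilb N) {O : Op N} (hO : O.IsHermitian) :
    (expect ψ O).im = 0 := by
  have h : star (expect ψ O) = expect ψ O := by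
    have hadj : ContinuousLinearMap.adjoint (Matrix.toEuclideanCLM (n := Bits N) (𝕜 := ℂ) O)
        = Matrix.toEuclideanCLM (n := Bits N) (𝕜 := ℂ) O := by
      rw [← ContinuousLinearMap.star_eq_adjoint, ← map_star, Matrix.star_eq_conjTranspose, hO.eq]
    calc star (expect ψ O)
        = inner ℂ (Matrix.toEuclideanCLM (n := Bits N) (𝕜 := ℂ) O ψ) ψ := inner_conj_symm _ _
      _ = expect ψ O := by
        rw [← ContinuousLinearMap.adjoint_inner_right, hadj, expect]
  exact Complex.conj_eq_iff_im.mp h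

/-! ### Determinants near the identity and ellipsoids -/

lemma exp_sub_two_mul_sq_le {x : ℝ} (hx : -(1 / 2) ≤ x) : Real.exp (x - 2 * x ^ 2) ≤ 1 + x := by
  have h0 : 0 < 1 + x := by linarith
  rw [← Real.le_log_iff_exp_le h0]
  refine le_trans ?_ (Real.one_sub_inv_le_log_of_pos h0)
  have : 1 - (1 + x)⁻¹ - (x - 2 * x ^ 2) = x ^ 2 * (1 + 2 * x) / (1 + x) := by
    field_simp; ring
  have : 0 ≤ x ^ 2 * (1 + 2 * x) / (1 + x) := by
    have : 0 ≤ 1 + 2 * x := by linarith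
    positivity
  linarith

open scoped ComplexOrder in
/-- The second-order expansion of `log det T` at the identity, as a lower bound. -/
lemma posDef_and_exp_le_det {n : Type*} [Fintype n] [DecidableEq n] [Nonempty n]
    {T : Matrix n n ℂ} (hT : T.IsHermitian) {η : ℝ} (hη : ‖T - 1‖ ≤ η) (hη' : η ≤ 1 / 2) :
    T.PosDef ∧
      Real.exp (T.trace.re - Fintype.card n - 2 * Fintype.card n * η ^ 2) ≤ ‖T.det‖ := by
  have hev : ∀ i, |hT.eigenvalues i - 1| ≤ η := by
    intro i
    have h := hT.eigenvalues_mem_spectrum_real i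
    have h2 : hT.eigenvalues i - 1 ∈ spectrum ℝ (T - 1) := by
      have := spectrum.sub_singleton_eq T (1 : ℝ)
      rw [map_one] at this
      rw [← this]
      exact Set.sub_mem_sub h rfl
    exact (spectrum.norm_le_norm_of_mem h2).trans hη
  have hlow : ∀ i, Real.exp (hT.eigenvalues i - 1 - 2 * η ^ 2) ≤ hT.eigenvalues i := by
    intro i
    have h1 := abs_le.mp (hev i)
    have h2 : (hT.eigenvalues i - 1) ^ 2 ≤ η ^ 2 := sq_le_sq' h1.1 h1.2
    calc _ ≤ Real.exp (hT.eigenvalues i - 1 - 2 * (hT.eigenvalues i - 1) ^ 2) := by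
            gcongr
      _ ≤ 1 + (hT.eigenvalues i - 1) := exp_sub_two_mul_sq_le (by linarith)
      _ = _ := by ring
  have hpos : ∀ i, 0 < hT.eigenvalues i := fun i => (Real.exp_pos _).trans_le (hlow i)
  refine ⟨hT.posDef_iff_eigenvalues_pos.mpr hpos, ?_⟩
  have htr : T.trace.re = ∑ i, hT.eigenvalues i := by
    rw [hT.trace_eq_sum_eigenvalues]; simp
  have hdet : ‖T.det‖ = ∏ i, hT.eigenvalues i := by
    rw [hT.det_eq_prod_eigenvalues, norm_prod]
    refine Finset.prod_congr rfl fun i _ => ?_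
    simp [abs_of_pos (hpos i)]
  rw [htr, hdet]
  calc _ = ∏ i, Real.exp (hT.eigenvalues i - 1 - 2 * η ^ 2) := by
          rw [← Real.exp_sum]
          congr 1
          simp [Finset.sum_sub_distrib]
          ring
    _ ≤ _ := Finset.prod_le_prod (fun i _ => (Real.exp_pos _).le) fun i _ => hlow i

/-- The real Jacobian of a complex linear map is the squared modulus of its determinant. -/
lemma volume_norm_lt_one {N : ℕ} (B : Op N) (hB : B.det ≠ 0) :
    (volume : Measure (Hilb N))
        {x | ‖Matrix.toEuclideanCLM (n := Bits N) (𝕜 := ℂ) B x‖ < 1} =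
      ENNReal.ofReal (‖B.det‖ ^ 2)⁻¹ * (volume : Measure (Hilb N)) (Metric.ball 0 1) := by
  set L : Hilb N →ₗ[ℝ] Hilb N := (Matrix.toEuclideanLin B).restrictScalars ℝ with hL
  have hdetC : LinearMap.det (Matrix.toEuclideanLin B) = B.det :=
    (congrArg (fun f => LinearMap.det (f B)) (Matrix.toLpLin_eq_toLin 2 2)).trans
      (LinearMap.det_toLin _ B)
  have hdet : LinearMap.det L = ‖B.det‖ ^ 2 := by
    rw [hL, LinearMap.det_restrictScalars, hdetC, Algebra.norm_complex_eq]
    exact Complex.normSq_eq_norm_sq _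
  have h0 : LinearMap.det L ≠ 0 := by rw [hdet]; positivity
  have := Measure.addHaar_preimage_linearMap (volume : Measure (Hilb N)) h0 (Metric.ball 0 1)
  rw [hdet, abs_of_nonneg (by positivity)] at this
  rw [← this]
  congr 1
  ext x
  simp [hL]
  rfl

/-! ### Concentration of quadratic forms on the sphere -/

/-- The probability of a set of states is the fraction of the unit ball filled by the cone over
it. -/
lemma uniformState_apply {N : ℕ} {S : Set (PureState N)} (hS : MeasurableSet S) :
    uniformState N S = (volume : Measure (Hilb N)) (Set.Ioo (0 : ℝ) 1 • (Subtype.val '' S)) /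
      (volume : Measure (Hilb N)) (Metric.ball 0 1) := by
  have hd : (Module.finrank ℝ (Hilb N) : ENNReal) ≠ 0 := by
    have : 0 < Module.finrank ℝ (Hilb N) := Module.finrank_pos
    exact_mod_cast this.ne'
  rw [uniformState, Measure.smul_apply, Measure.toSphere_apply_univ, Measure.toSphere_apply' _ hS,
    smul_eq_mul, ENNReal.mul_inv (Or.inl hd) (Or.inl (ENNReal.natCast_ne_top _)),
    mul_mul_mul_comm, ENNReal.inv_mul_cancel hd (ENNReal.natCast_ne_top _), one_mul, mul_comm]
  rfl

instance isProbabilityMeasure_uniformState (N : ℕ) : IsProbabilityMeasure (uniformState N) where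
  measure_univ := by
    rw [uniformState, Measure.smul_apply, smul_eq_mul]
    refine ENNReal.inv_mul_cancel ?_ (measure_ne_top _ _)
    rw [Measure.toSphere_apply_univ]
    refine mul_ne_zero ?_ (Metric.measure_ball_pos _ _ one_pos).ne'
    have : 0 < Module.finrank ℝ (Hilb N) := Module.finrank_pos
    exact_mod_cast this.ne'

open scoped MatrixOrder ComplexOrder in
/-- The part in the unit ball of a cone on which `H` is large lies in the ellipsoid `⟨x|T|x⟩ < 1`
with `T = (1 + s δ) - s H`, whose volume relative to the ball is `1 / det T`. -/
lemma uniformState_expect_ge_le {N : ℕ} {H : Op N} (hH : H.IsHermitian) (htr : H.trace = 0)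
    {Λ δ : ℝ} (hΛ : ‖H‖ ≤ Λ) (hδ : 0 < δ) (hδΛ : δ ≤ Λ) :
    uniformState N {ψ | δ ≤ (expect ψ.1 H).re} ≤
      ENNReal.ofReal (Real.exp (-(2 ^ N * δ ^ 2 / (32 * Λ ^ 2)))) := by
  have hΛ0 : 0 < Λ := hδ.trans_le hδΛ
  -- This `s` maximizes `s δ - 8 s² Λ²`, the exponent gained per dimension.
  set s : ℝ := δ / (16 * Λ ^ 2) with hs
  have hs0 : 0 < s := by positivity
  set T : Op N := ((1 + s * δ : ℝ) : ℂ) • (1 : Op N) - (s : ℂ) • H with hTdef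
  have hT : T.IsHermitian := by
    simp [Matrix.IsHermitian, hTdef, Matrix.conjTranspose_sub, Matrix.conjTranspose_smul, hH.eq]
  have hsΛ : s * Λ ≤ 1 / 16 := by
    rw [hs, div_mul_eq_mul_div, div_le_iff₀ (by positivity)]
    nlinarith
  have hη : ‖T - 1‖ ≤ 2 * s * Λ := by
    have : T - 1 = ((s * δ : ℝ) : ℂ) • (1 : Op N) - (s : ℂ) • H := by
      rw [hTdef]; push_cast; module
    rw [this]
    refine (norm_sub_le _ _).trans ?_
    rw [norm_smul, norm_smul, Complex.norm_real, Complex.norm_real, norm_one,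
      Real.norm_of_nonneg (by positivity), Real.norm_of_nonneg hs0.le]
    nlinarith
  obtain ⟨hPD, hdet⟩ := posDef_and_exp_le_det hT hη (by linarith)
  have hcard : (Fintype.card (Bits N) : ℝ) = 2 ^ N := by simp
  have htrT : T.trace.re = 2 ^ N * (1 + s * δ) := by
    have h : T.trace = (((1 + s * δ) * 2 ^ N : ℝ) : ℂ) := by
      rw [hTdef, Matrix.trace_sub, Matrix.trace_smul, Matrix.trace_smul, htr, Matrix.trace_one]
      simp
    rw [h, Complex.ofReal_re, mul_comm]
  have hexp : T.trace.re - Fintype.card (Bits N) - 2 * Fintype.card (Bits N) * (2 * s * Λ) ^ 2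
      = 2 ^ N * δ ^ 2 / (32 * Λ ^ 2) := by
    rw [htrT, hcard, hs]
    field_simp
    ring
  rw [hexp] at hdet
  obtain ⟨B, hB⟩ := CStarAlgebra.nonneg_iff_eq_star_mul_self.mp hPD.posSemidef.nonneg
  rw [Matrix.star_eq_conjTranspose] at hB
  have hdetB : ‖B.det‖ ^ 2 = ‖T.det‖ := by
    rw [hB, Matrix.det_mul, Matrix.det_conjTranspose, norm_mul, norm_star, sq]
  have hB0 : B.det ≠ 0 := by
    intro h
    rw [h] at hdetB
    have := (Real.exp_pos _).trans_le hdet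
    simp [← hdetB] at this
  have hmeas : MeasurableSet {ψ : PureState N | δ ≤ (expect ψ.1 H).re} := by
    refine (isClosed_le continuous_const ?_).measurableSet
    exact Complex.continuous_re.comp ((continuous_expect H).comp continuous_subtype_val)
  -- `‖B x‖ ^ 2 = ⟨x|T|x⟩ ≤ ‖x‖ ^ 2 < 1` on the cone.
  have hsub : Set.Ioo (0 : ℝ) 1 • (Subtype.val '' {ψ : PureState N | δ ≤ (expect ψ.1 H).re}) ⊆
      {x : Hilb N | ‖Matrix.toEuclideanCLM (n := Bits N) (𝕜 := ℂ) B x‖ < 1} := by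
    rintro _ ⟨r, ⟨hr0, hr1⟩, _, ⟨ψ, hψ, rfl⟩, rfl⟩
    have hψ1 : ‖ψ.1‖ = 1 := by simp
    have h1 : expect (r • ψ.1) T
        = (r ^ 2 : ℝ) * (((1 + s * δ : ℝ) : ℂ) - s * expect ψ.1 H) := by
      rw [expect_real_smul_left, hTdef, sub_eq_add_neg, expect_add, expect_neg, expect_smul,
        expect_smul, expect_one, hψ1]
      push_cast
      ring
    have h2 := expect_conjTranspose_mul_self (r • ψ.1) B
    rw [← hB, h1] at h2
    have h3 := congrArg Complex.re h2
    rw [Complex.re_ofReal_mul, Complex.ofReal_re, Complex.sub_re, Complex.re_ofReal_mul,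
      Complex.ofReal_re] at h3
    have h4 : s * δ ≤ s * (expect ψ.1 H).re := mul_le_mul_of_nonneg_left hψ hs0.le
    have h5 : ‖Matrix.toEuclideanCLM (n := Bits N) (𝕜 := ℂ) B (r • ψ.1)‖ ^ 2 < 1 := by
      rw [← h3]
      nlinarith [sq_nonneg r]
    exact (sq_lt_one_iff₀ (norm_nonneg _)).mp h5
  rw [uniformState_apply hmeas]
  refine ENNReal.div_le_of_le_mul ((measure_mono hsub).trans ?_)
  rw [volume_norm_lt_one B hB0, hdetB, Real.exp_neg]
  gcongr

/-! ### Pauli strings -/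

/-- The identity and the three Pauli matrices; the index `0` is the identity. -/
def pauliMatrix : Fin 4 → Matrix (Fin 2) (Fin 2) ℂ :=
  ![1, !![0, 1; 1, 0], !![0, -Complex.I; Complex.I, 0], !![1, 0; 0, -1]]

/-- The Pauli string `⨂ i, σ (s i)` on `N` qubits. -/
def pauli {N : ℕ} (s : Fin N → Fin 4) : Op N :=
  fun x y => ∏ i, pauliMatrix (s i) (x i) (y i)

/-- The Pauli strings that differ from the identity on at most `k` qubits. -/
def lowWeight (N k : ℕ) : Finset (Fin N → Fin 4) :=
  {s | ({i | s i ≠ 0} : Finset (Fin N)).card ≤ k}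

lemma pauliMatrix_swap (a : Fin 4) (x y : Fin 2) :
    star (pauliMatrix a y x) = pauliMatrix a x y := by
  fin_cases a <;> fin_cases x <;> fin_cases y <;> simp [pauliMatrix]

lemma sum_pauliMatrix_mul_self (a : Fin 4) (x y : Fin 2) :
    ∑ z, pauliMatrix a x z * pauliMatrix a z y = if x = y then 1 else 0 := by
  fin_cases a <;> fin_cases x <;> fin_cases y <;> simp [pauliMatrix]

/-- Completeness of the Pauli matrices. -/
lemma sum_pauliMatrix_mul_pauliMatrix (x y w z : Fin 2) :
    ∑ a, pauliMatrix a x y * pauliMatrix a w z = if z = x ∧ w = y then 2 else 0 := by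
  fin_cases x <;> fin_cases y <;> fin_cases w <;> fin_cases z <;>
    simp [pauliMatrix, Fin.sum_univ_four] <;> norm_num

lemma pauliMatrix_flip {a : Fin 4} (ha : a ≠ 0) (x : Fin 2) :
    pauliMatrix a (x + 1) (x + 1) = -pauliMatrix a x x := by
  fin_cases a <;> fin_cases x <;> simp [pauliMatrix] at ha ⊢

lemma pauli_isHermitian {N : ℕ} (s : Fin N → Fin 4) : (pauli s).IsHermitian := by
  ext x y
  simp only [Matrix.conjTranspose_apply, pauli]
  rw [star_prod]
  exact Finset.prod_congr rfl fun i _ => pauliMatrix_swap _ _ _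

lemma pauli_mul_self {N : ℕ} (s : Fin N → Fin 4) : pauli s * pauli s = 1 := by
  ext x y
  have h := Finset.prod_univ_sum (fun _ : Fin N => (Finset.univ : Finset (Fin 2)))
    fun i z => pauliMatrix (s i) (x i) z * pauliMatrix (s i) z (y i)
  rw [Fintype.piFinset_univ] at h
  simp only [Matrix.mul_apply, pauli, ← Finset.prod_mul_distrib]
  rw [← h]
  simp only [sum_pauliMatrix_mul_self, Matrix.one_apply, funext_iff]
  simp [Finset.prod_ite_zero]

lemma norm_pauli {N : ℕ} (s : Fin N → Fin 4) : ‖pauli s‖ = 1 := by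
  refine CStarRing.norm_of_mem_unitary ?_
  rw [Unitary.mem_iff, Matrix.star_eq_conjTranspose, (pauli_isHermitian s).eq]
  exact ⟨pauli_mul_self s, pauli_mul_self s⟩

lemma sum_pauli_mul_pauli {N : ℕ} (x y w z : Bits N) :
    ∑ s : Fin N → Fin 4, pauli s x y * pauli s w z = if z = x ∧ w = y then 2 ^ N else 0 := by
  have h := Finset.prod_univ_sum (fun _ : Fin N => (Finset.univ : Finset (Fin 4)))
    fun i a => pauliMatrix a (x i) (y i) * pauliMatrix a (w i) (z i)
  rw [Fintype.piFinset_univ] at h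
  simp only [pauli, ← Finset.prod_mul_distrib]
  rw [← h]
  simp only [sum_pauliMatrix_mul_pauliMatrix, funext_iff, ← forall_and]
  split_ifs with hc
  · simp [hc]
  · obtain ⟨i, hi⟩ := not_forall.mp hc
    exact Finset.prod_eq_zero (Finset.mem_univ i) (if_neg hi)

/-- The expansion of an operator in Pauli strings, with normalized traces as coefficients. -/
lemma sum_trace_pauli_smul {N : ℕ} (X : Op N) :
    ∑ s : Fin N → Fin 4, ((pauli s * X).trace / 2 ^ N) • pauli s = X := by
  ext x y
  simp only [Matrix.sum_apply, Matrix.smul_apply, smul_eq_mul, Matrix.trace, Matrix.diag_apply,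
    Matrix.mul_apply]
  have h1 : ∀ s : Fin N → Fin 4, (∑ w, ∑ z, pauli s w z * X z w) / 2 ^ N * pauli s x y
      = ∑ w, ∑ z, X z w / 2 ^ N * (pauli s x y * pauli s w z) := by
    intro s
    rw [Finset.sum_div, Finset.sum_mul]
    refine Finset.sum_congr rfl fun w _ => ?_
    rw [Finset.sum_div, Finset.sum_mul]
    exact Finset.sum_congr rfl fun z _ => by ring
  simp only [h1]
  rw [Finset.sum_comm]
  have h2 : ∀ w, ∑ s : Fin N → Fin 4, ∑ z, X z w / 2 ^ N * (pauli s x y * pauli s w z)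
      = if w = y then X x y else 0 := by
    intro w
    rw [Finset.sum_comm]
    simp only [← Finset.mul_sum, sum_pauli_mul_pauli]
    by_cases hw : w = y <;> simp [hw]
  simp [h2]

/-- Flipping a qubit `i` outside the support of `X` in both indices changes the sign of every
nonzero term of the trace. -/
lemma trace_pauli_mul_eq_zero_of_actsOn {N : ℕ} {S : Finset (Fin N)} {X : Op N}
    (hX : ActsOn S X) {s : Fin N → Fin 4} {i : Fin N} (hi : i ∉ S) (hs : s i ≠ 0) :
    (pauli s * X).trace = 0 := by
  obtain ⟨b, hb⟩ := hX
  set e : Bits N := Pi.single i 1 with he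
  have hne : ∀ (x : Bits N) {j}, j ≠ i → (x + e) j = x j := by
    intro x j hj; simp [he, hj]
  have heq : ∀ x : Bits N, (x + e) i = x i + 1 := by intro x; simp [he]
  have hXflip : ∀ x y, X (x + e) (y + e) = X x y := by
    intro x y
    rw [hb, hb]
    have h1 : (∀ j, j ∉ S → (x + e) j = (y + e) j) ↔ ∀ j, j ∉ S → x j = y j := by simp
    have h2 : ∀ x : Bits N, (fun j : S => (x + e) j) = fun j : S => x j :=
      fun x => funext fun j => hne x fun h => hi (h ▸ j.2)
    simp only [h1, h2]
  have hflip : ∀ x y, pauli s (x + e) (y + e) * X (y + e) (x + e) = -(pauli s x y * X y x) := by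
    intro x y
    rw [hXflip]
    by_cases h : y i = x i
    · rw [← neg_mul]
      congr 1
      simp only [pauli]
      rw [← Finset.mul_prod_erase _ _ (Finset.mem_univ i),
        ← Finset.mul_prod_erase Finset.univ (fun j => pauliMatrix (s j) (x j) (y j))
          (Finset.mem_univ i), ← neg_mul]
      congr 1
      · rw [heq, heq, h, pauliMatrix_flip hs]
      · refine Finset.prod_congr rfl fun j hj => ?_
        rw [hne x (Finset.ne_of_mem_erase hj), hne y (Finset.ne_of_mem_erase hj)]
    · have : X y x = 0 := by
        rw [hb]
        exact if_neg fun h' => h (h' i hi)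
      simp [this]
  have key : (pauli s * X).trace = -(pauli s * X).trace := by
    simp only [Matrix.trace, Matrix.diag_apply, Matrix.mul_apply]
    rw [← Finset.sum_neg_distrib]
    simp only [← Finset.sum_neg_distrib, ← hflip]
    rw [← Equiv.sum_comp (Equiv.addRight e)]
    refine Finset.sum_congr rfl fun x _ => ?_
    rw [← Equiv.sum_comp (Equiv.addRight e)]
    rfl
  exact self_eq_neg.mp key

lemma trace_pauli_mul_eq_zero_of_isLocal {N k : ℕ} {X : Op N} (hX : IsLocal k X)
    {s : Fin N → Fin 4} (hs : s ∉ lowWeight N k) : (pauli s * X).trace = 0 := by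
  obtain ⟨r, B, hB, rfl⟩ := hX
  rw [Matrix.mul_sum, Matrix.trace_sum]
  refine Finset.sum_eq_zero fun j _ => ?_
  obtain ⟨S, hS, hact⟩ := hB j
  have hcard : ¬ ({i | s i ≠ 0} : Finset (Fin N)).card ≤ k := by simpa [lowWeight] using hs
  obtain ⟨i, hi, hiS⟩ := Finset.exists_mem_notMem_of_card_lt_card
    (hS.trans_lt (not_le.mp hcard))
  exact trace_pauli_mul_eq_zero_of_actsOn hact hiS (by simpa using hi)

lemma card_lowWeight_le (N k : ℕ) : (lowWeight N k).card ≤ (4 * N + 1) ^ k := by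
  induction k with
  | zero =>
    refine Finset.card_le_one.mpr fun s hs t ht => ?_
    simp [lowWeight, Finset.filter_eq_empty_iff] at hs ht
    ext i
    rw [hs, ht]
  | succ k ih =>
    -- A string of weight `k + 1` arises from one of weight `k` by replacing one letter.
    have hsub : lowWeight N (k + 1) ⊆ lowWeight N k ∪
        (lowWeight N k ×ˢ (Finset.univ : Finset (Fin N × Fin 4))).image
          fun p => Function.update p.1 p.2.1 p.2.2 := by
      intro s hs
      rw [Finset.mem_union]
      by_cases h0 : ({i | s i ≠ 0} : Finset (Fin N)) = ∅
      · left; simp [lowWeight, h0]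
      · right
        obtain ⟨i, hi⟩ := Finset.nonempty_iff_ne_empty.mpr h0
        refine Finset.mem_image.mpr ⟨(Function.update s i 0, i, s i), ?_, by simp⟩
        simp only [Finset.mem_product, Finset.mem_univ, and_true]
        have : ({j | Function.update s i 0 j ≠ 0} : Finset (Fin N))
            = ({j | s j ≠ 0} : Finset (Fin N)).erase i := by
          ext j
          by_cases hj : j = i <;> simp [hj]
        simp only [lowWeight, Finset.mem_filter, Finset.mem_univ, true_and] at hs ⊢
        rw [this, Finset.card_erase_of_mem hi]
        omega
    calc _ ≤ _ := Finset.card_le_card hsub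
      _ ≤ (lowWeight N k).card + (lowWeight N k).card * (N * 4) := by
        refine (Finset.card_union_le _ _).trans (Nat.add_le_add_left ?_ _)
        refine Finset.card_image_le.trans ?_
        simp [Finset.card_product]
      _ = (lowWeight N k).card * (4 * N + 1) := by ring
      _ ≤ _ := by rw [pow_succ]; gcongr

/-! ### Reduction to commutators with Pauli strings -/

lemma norm_trace_le {N : ℕ} (Y : Op N) : ‖Y.trace‖ ≤ 2 ^ N * ‖Y‖ := by
  have hentry : ∀ x, ‖Y x x‖ ≤ ‖Y‖ := by
    intro x
    have h : Y x x = expect (EuclideanSpace.single x 1) Y := by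
      rw [expect, EuclideanSpace.inner_single_left]
      simp
    rw [h, expect]
    refine (norm_inner_le_norm _ _).trans ?_
    have := (Matrix.toEuclideanCLM (n := Bits N) (𝕜 := ℂ) Y).le_opNorm
      (EuclideanSpace.single x 1)
    rw [Matrix.l2_opNorm_toEuclideanCLM] at this
    simpa using this
  calc _ ≤ ∑ x, ‖Y x x‖ := norm_sum_le _ _
    _ ≤ ∑ _x : Bits N, ‖Y‖ := Finset.sum_le_sum fun x _ => hentry x
    _ = _ := by simp

lemma norm_trace_pauli_mul_div_le {N : ℕ} (s : Fin N → Fin 4) (X : Op N) :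
    ‖(pauli s * X).trace / 2 ^ N‖ ≤ ‖X‖ := by
  rw [norm_div, norm_pow, Complex.norm_ofNat, div_le_iff₀ (by positivity), mul_comm]
  refine (norm_trace_le _).trans ?_
  gcongr
  simpa [norm_pauli] using norm_mul_le (pauli s) X

/-- The Nash condition for `X` follows from the bounds for the low-weight Pauli strings, because the
Pauli coefficients of `X` are at most `‖X‖`. -/
lemma norm_expect_commutator_le {N k : ℕ} {ψ : Hilb N} {h X : Op N} {δ : ℝ}
    (hX : ∀ s, s ∉ lowWeight N k → (pauli s * X).trace = 0)
    (hψ : ∀ s ∈ lowWeight N k, ‖expect ψ (h * pauli s - pauli s * h)‖ ≤ δ) :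
    ‖expect ψ (h * X - X * h)‖ ≤ (lowWeight N k).card * δ * ‖X‖ := by
  have hexp : h * X - X * h = ∑ s ∈ lowWeight N k,
      ((pauli s * X).trace / 2 ^ N) • (h * pauli s - pauli s * h) := by
    have hX' : X = ∑ s ∈ lowWeight N k, ((pauli s * X).trace / 2 ^ N) • pauli s := by
      conv_lhs => rw [← sum_trace_pauli_smul X]
      refine (Finset.sum_subset (Finset.subset_univ _) fun s _ hs => ?_).symm
      simp [hX s hs]
    conv_lhs => rw [hX']
    rw [Matrix.mul_sum, Matrix.sum_mul, ← Finset.sum_sub_distrib]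
    simp [smul_sub]
  rw [hexp, expect_sum]
  refine (norm_sum_le_of_le _ fun s hs => ?_ :
    _ ≤ ∑ _s ∈ lowWeight N k, δ * ‖X‖).trans_eq (by simp [mul_assoc])
  rw [expect_smul, norm_mul, mul_comm]
  exact mul_le_mul (hψ s hs) (norm_trace_pauli_mul_div_le s X) (norm_nonneg _)
    ((norm_nonneg _).trans (hψ s hs))

/-! ### The union bound -/

lemma isHermitian_I_smul_commutator {N : ℕ} {h P : Op N} (hh : h.IsHermitian)
    (hP : P.IsHermitian) : (Complex.I • (h * P - P * h)).IsHermitian := by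
  rw [Matrix.IsHermitian, Matrix.conjTranspose_smul, Matrix.conjTranspose_sub,
    Matrix.conjTranspose_mul, Matrix.conjTranspose_mul, hh.eq, hP.eq]
  simp [sub_eq_add_neg, add_comm]

lemma norm_expect_eq_abs_re {N : ℕ} (ψ : Hilb N) {Z : Op N}
    (hZ : (Complex.I • Z).IsHermitian) :
    ‖expect ψ Z‖ = |(expect ψ (Complex.I • Z)).re| := by
  have him := expect_im_of_isHermitian ψ hZ
  calc ‖expect ψ Z‖ = ‖expect ψ (Complex.I • Z)‖ := by simp [expect_smul]
    _ = _ := (Complex.abs_re_eq_norm.mpr him).symm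

lemma measureReal_norm_expect_commutator_ge_le {N : ℕ} {h P : Op N} (hh : h.IsHermitian)
    (hP : P.IsHermitian) (hP1 : ‖P‖ = 1) {Λ δ : ℝ} (hΛ : 2 * ‖h‖ ≤ Λ) (hδ : 0 < δ)
    (hδΛ : δ ≤ Λ) :
    (uniformState N).real {ψ | δ ≤ ‖expect ψ.1 (h * P - P * h)‖} ≤
      2 * Real.exp (-(2 ^ N * δ ^ 2 / (32 * Λ ^ 2))) := by
  set Z := h * P - P * h with hZ
  have hherm := isHermitian_I_smul_commutator hh hP
  have htr : (Complex.I • Z).trace = 0 := by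
    rw [Matrix.trace_smul, hZ, Matrix.trace_sub, Matrix.trace_mul_comm, sub_self, smul_zero]
  have hnorm : ‖Complex.I • Z‖ ≤ Λ := by
    rw [norm_smul, Complex.norm_I, one_mul]
    refine (norm_sub_le _ _).trans ?_
    have h1 := norm_mul_le h P
    have h2 := norm_mul_le P h
    rw [hP1] at h1 h2
    linarith
  have hexp0 := (Real.exp_pos (-(2 ^ N * δ ^ 2 / (32 * Λ ^ 2)))).le
  have hplus : (uniformState N).real {ψ | δ ≤ (expect ψ.1 (Complex.I • Z)).re} ≤ _ :=
    ENNReal.toReal_le_of_le_ofReal hexp0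
      (uniformState_expect_ge_le hherm htr hnorm hδ hδΛ)
  have hminus : (uniformState N).real {ψ | δ ≤ (expect ψ.1 (-(Complex.I • Z))).re} ≤ _ :=
    ENNReal.toReal_le_of_le_ofReal hexp0
      (uniformState_expect_ge_le hherm.neg (by rw [Matrix.trace_neg, htr, neg_zero])
        (by rwa [norm_neg]) hδ hδΛ)
  have hsub : {ψ : PureState N | δ ≤ ‖expect ψ.1 Z‖} ⊆
      {ψ | δ ≤ (expect ψ.1 (Complex.I • Z)).re} ∪
        {ψ | δ ≤ (expect ψ.1 (-(Complex.I • Z))).re} := by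
    intro ψ hψ
    rw [Set.mem_ofPred_eq, norm_expect_eq_abs_re _ hherm] at hψ
    simpa [expect_neg] using le_abs.mp hψ
  refine (measureReal_mono hsub).trans ((measureReal_union_le _ _).trans ?_)
  linarith

lemma IsNormalizedBasis.norm_sum_smul_le {N m : ℕ} {G : Subgroup (U N)} {A : Fin m → Op N}
    (hA : IsNormalizedBasis G A) (v : Fin m → ℝ) : ‖∑ α, v α • A α‖ ≤ ∑ α, |v α| := by
  refine norm_sum_le_of_le _ fun α _ => ?_
  rw [norm_smul, hA.2.2 α, mul_one, Real.norm_eq_abs]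

/-- Every basis of the Lie algebra spans the same real space as the given local basis, hence has no
Pauli components of high weight. -/
lemma IsNormalizedBasis.trace_pauli_mul_eq_zero {N k m m' : ℕ} {G : Subgroup (U N)}
    {A : Fin m → Op N} {A' : Fin m' → Op N} (hA : IsNormalizedBasis G A)
    (hloc : ∀ α, IsLocal k (A α)) (hA' : IsNormalizedBasis G A') (v : Fin m' → ℝ)
    {s : Fin N → Fin 4} (hs : s ∉ lowWeight N k) :
    (pauli s * ∑ α, v α • A' α).trace = 0 := by
  have hmem : ∑ α, v α • A' α ∈ Submodule.span ℝ (Set.range A) := by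
    have hspan : Submodule.span ℝ (Set.range A) = Submodule.span ℝ (Set.range A') :=
      SetLike.coe_injective (hA.2.1.trans hA'.2.1.symm)
    rw [hspan]
    exact Submodule.sum_mem _ fun α _ =>
      Submodule.smul_mem _ _ (Submodule.subset_span (Set.mem_range_self α))
  generalize ∑ α, v α • A' α = X at hmem
  induction hmem using Submodule.span_induction with
  | mem X hX =>
    obtain ⟨α, rfl⟩ := hX
    exact trace_pauli_mul_eq_zero_of_isLocal (hloc α) hs
  | zero => simp
  | add X Y _ _ hX hY => rw [Matrix.mul_add, Matrix.trace_add, hX, hY, add_zero]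
  | smul a X _ hX => rw [Matrix.mul_smul, Matrix.trace_smul, hX, smul_zero]

/-- Only `M` times the number of low-weight Pauli strings many commutators have to be controlled,
although the definition of a Nash state involves infinitely many bases. -/
lemma one_sub_le_measureReal_isApproxNash {N k M : ℕ} {h : Fin M → Op N}
    {G : Fin M → Subgroup (U N)} {m : Fin M → ℕ} {A : ∀ i, Fin (m i) → Op N}
    (hh : ∀ i, (h i).IsHermitian) (hloc : ∀ i α, IsLocal k (A i α))
    (hA : ∀ i, IsNormalizedBasis (G i) (A i)) {Λ δ ε : ℝ} (hΛ : ∀ i, 2 * ‖h i‖ ≤ Λ)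
    (hδ : 0 < δ) (hδΛ : δ ≤ Λ) (hε : (lowWeight N k).card * δ ≤ ε) :
    1 - M * (lowWeight N k).card * (2 * Real.exp (-(2 ^ N * δ ^ 2 / (32 * Λ ^ 2)))) ≤
      (uniformState N).real {ψ | IsApproxNash ε h G ψ.1} := by
  set I := (Finset.univ : Finset (Fin M)) ×ˢ lowWeight N k
  set bad : Fin M × (Fin N → Fin 4) → Set (PureState N) := fun p =>
    {ψ | δ ≤ ‖expect ψ.1 (h p.1 * pauli p.2 - pauli p.2 * h p.1)‖}
  have hcover : (Set.univ : Set (PureState N)) ⊆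
      {ψ | IsApproxNash ε h G ψ.1} ∪ ⋃ p ∈ I, bad p := by
    intro ψ _
    by_cases hψ : ψ ∈ ⋃ p ∈ I, bad p
    · exact Or.inr hψ
    left
    intro i m' A' hA' v
    have hgood : ∀ s ∈ lowWeight N k,
        ‖expect ψ.1 (h i * pauli s - pauli s * h i)‖ ≤ δ := by
      intro s hs
      by_contra hcon
      have hI : (i, s) ∈ I := Finset.mem_product.mpr ⟨Finset.mem_univ i, hs⟩
      have hmem : ψ ∈ bad (i, s) := le_of_not_ge hcon
      exact hψ (Set.mem_iUnion₂.mpr ⟨(i, s), hI, hmem⟩)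
    calc _ ≤ (lowWeight N k).card * δ * ‖∑ α, v α • A' α‖ :=
          norm_expect_commutator_le
            (fun s hs => (hA i).trace_pauli_mul_eq_zero (hloc i) hA' v hs) hgood
      _ ≤ ε * ∑ α, |v α| :=
          mul_le_mul hε (hA'.norm_sum_smul_le v) (norm_nonneg _)
            (le_trans (by positivity) hε)
  have hbad : (uniformState N).real (⋃ p ∈ I, bad p) ≤
      M * (lowWeight N k).card * (2 * Real.exp (-(2 ^ N * δ ^ 2 / (32 * Λ ^ 2)))) := by
    calc _ ≤ ∑ p ∈ I, (uniformState N).real (bad p) := measureReal_biUnion_finset_le _ _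
      _ ≤ ∑ _p ∈ I, 2 * Real.exp (-(2 ^ N * δ ^ 2 / (32 * Λ ^ 2))) :=
        Finset.sum_le_sum fun p _ => measureReal_norm_expect_commutator_ge_le (hh p.1)
          (pauli_isHermitian p.2) (norm_pauli p.2) (hΛ p.1) hδ hδΛ
      _ = _ := by
        rw [Finset.sum_const, Finset.card_product, Finset.card_univ, Fintype.card_fin,
          nsmul_eq_mul, Nat.cast_mul]
  have h1 := (measureReal_mono hcover).trans (measureReal_union_le (μ := uniformState N) _ _)
  rw [probReal_univ] at h1
  linarith

/-! ### Growth estimates -/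

lemma eventually_const_mul_pow_le (a : ℝ) (r : ℕ) :
    ∀ᶠ N : ℕ in atTop, a * (N : ℝ) ^ r ≤ (2 : ℝ) ^ ((N : ℝ) / 4) := by
  have hb : 1 < (2 : ℝ) ^ ((1 : ℝ) / 4) := Real.one_lt_rpow (by norm_num) (by norm_num)
  have h := ((isLittleO_pow_const_const_pow_of_one_lt (R := ℝ) r hb).const_mul_left a).bound one_pos
  filter_upwards [h] with N hN
  rw [one_mul] at hN
  refine (le_abs_self _).trans (hN.trans_eq ?_)
  rw [Real.norm_of_nonneg (by positivity), ← Real.rpow_natCast, ← Real.rpow_mul (by norm_num)]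
  congr 1
  ring

end NashStates

end

theorem mainTheorem6 (k c : ℕ) (C D : ℝ) :
    ∃ N₀ : ℕ, ∀ N : ℕ, N₀ ≤ N → ∀ M : ℕ, (M : ℝ) ≤ D * N →
      ∀ (h : Fin M → NashStates.Op N) (G : Fin M → Subgroup (NashStates.U N))
        (m : Fin M → ℕ) (A : ∀ i : Fin M, Fin (m i) → NashStates.Op N),
        (∀ i, (h i).IsHermitian) →
        (∀ i, NashStates.IsLocal k (h i)) →
        (∀ i, ‖h i‖ ≤ C * (N : ℝ) ^ c) →
        (∀ i α, (A i α)ᴴ = -A i α) →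
        (∀ i α, NashStates.IsLocal k (A i α)) →
        (∀ i, G i = NashStates.generatedGroup (A i)) →
        (∀ i, NashStates.IsNormalizedBasis (G i) (A i)) →
        1 - (2 : ℝ) ^ (-((2 : ℝ) ^ ((N : ℝ) / 4))) ≤
          (NashStates.uniformState N).real
            {ψ | NashStates.IsApproxNash ((2 : ℝ) ^ (-((N : ℝ) / 4))) h G ψ.1} := by
  have hpoly1 := NashStates.eventually_const_mul_pow_le (2 * (|D| * 5 ^ k)) (1 + k)
  have hpoly2 := NashStates.eventually_const_mul_pow_le
    (2 * (32 * (2 * (|C| + 1)) ^ 2 * (5 ^ k) ^ 2)) (2 * c + 2 * k)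
  obtain ⟨N₀, hN₀⟩ := Filter.eventually_atTop.mp
    ((hpoly1.and hpoly2).and (Filter.eventually_ge_atTop 1))
  refine ⟨N₀, fun N hN M hM h G m A hh _ hC _ hloc _ hA => ?_⟩
  obtain ⟨⟨h1, h2⟩, hN1⟩ := hN₀ N hN
  -- Everything is expressed through `b = 2 ^ (N / 4)`: the dimension is `b ^ 4`, and `N₀` is chosen
  -- so that `b` dominates the polynomials of the union bound and of the exponent.
  set b : ℝ := (2 : ℝ) ^ ((N : ℝ) / 4) with hb
  have hb0 : 0 < b := by positivity
  have hN1' : (1 : ℝ) ≤ N := by exact_mod_cast hN1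
  have hb1 : 1 ≤ b := Real.one_le_rpow (by norm_num) (by positivity)
  have hb4 : (2 : ℝ) ^ N = b ^ 4 := by
    rw [hb, ← Real.rpow_natCast, ← Real.rpow_natCast, ← Real.rpow_mul (by norm_num)]
    congr 1
    push_cast
    ring
  have hbinv : (2 : ℝ) ^ (-((N : ℝ) / 4)) = b⁻¹ := Real.rpow_neg (by norm_num) _
  -- `K` bounds the number of Pauli strings and `Λ` the norm of the commutators.
  set K : ℝ := 5 ^ k * N ^ k with hK
  have hK1 : 1 ≤ K := one_le_mul_of_one_le_of_one_le
    (one_le_pow₀ (by norm_num)) (one_le_pow₀ hN1')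
  have hcard : ((NashStates.lowWeight N k).card : ℝ) ≤ K := by
    calc ((NashStates.lowWeight N k).card : ℝ) ≤ (((4 * N + 1) ^ k : ℕ) : ℝ) := by
          exact_mod_cast NashStates.card_lowWeight_le N k
      _ ≤ ((5 * N : ℕ) : ℝ) ^ k := by
          push_cast
          gcongr
          linarith
      _ = K := by push_cast; rw [mul_pow]
  set Λ : ℝ := 2 * (|C| + 1) * N ^ c with hΛ
  have hΛ1 : 1 ≤ Λ := one_le_mul_of_one_le_of_one_le
    (by linarith [abs_nonneg C]) (one_le_pow₀ hN1')
  have hΛh : ∀ i, 2 * ‖h i‖ ≤ Λ := by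
    intro i
    have hCN : C * (N : ℝ) ^ c ≤ (|C| + 1) * N ^ c := by
      gcongr
      linarith [le_abs_self C]
    have := hC i
    rw [hΛ]
    linarith
  have hδ : 0 < b⁻¹ / K := by positivity
  have hδΛ : b⁻¹ / K ≤ Λ := by
    refine (div_le_self (by positivity) hK1).trans ?_
    exact (inv_le_one_of_one_le₀ hb1).trans hΛ1
  have hε : (NashStates.lowWeight N k).card * (b⁻¹ / K) ≤ b⁻¹ := by
    calc _ ≤ K * (b⁻¹ / K) := by gcongr
      _ = b⁻¹ := by field_simp
  rw [hbinv]
  refine le_trans (sub_le_sub_left ?_ 1)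
    (NashStates.one_sub_le_measureReal_isApproxNash hh hloc hA hΛh hδ hδΛ hε)
  have hMK : M * (NashStates.lowWeight N k).card * 2 ≤ b := by
    calc (M : ℝ) * (NashStates.lowWeight N k).card * 2 ≤ (|D| * N) * K * 2 := by
          gcongr
          exact hM.trans (by gcongr; exact le_abs_self D)
      _ = 2 * (|D| * 5 ^ k) * N ^ (1 + k) := by rw [hK]; ring
      _ ≤ b := h1
  have hexponent : 2 * b ≤ 2 ^ N * (b⁻¹ / K) ^ 2 / (32 * Λ ^ 2) := by
    have h3 : 2 * (32 * Λ ^ 2 * K ^ 2) ≤ b := by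
      refine le_trans (le_of_eq ?_) h2
      rw [hΛ, hK]
      ring
    rw [hb4]
    have : b ^ 4 * (b⁻¹ / K) ^ 2 / (32 * Λ ^ 2) = b ^ 2 / (32 * Λ ^ 2 * K ^ 2) := by
      field_simp
    rw [this, le_div_iff₀ (by positivity)]
    nlinarith
  calc _ = M * (NashStates.lowWeight N k).card * 2 *
        Real.exp (-(2 ^ N * (b⁻¹ / K) ^ 2 / (32 * Λ ^ 2))) := by ring
    _ ≤ Real.exp b * Real.exp (-(2 * b)) := by
        gcongr
        linarith [Real.add_one_le_exp b]
    _ = Real.exp (-b) := by rw [← Real.exp_add]; congr 1; ring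
    _ ≤ (2 : ℝ) ^ (-b) := by
        rw [Real.rpow_def_of_pos (by norm_num)]
        have : Real.log 2 ≤ 1 := by linarith [Real.log_two_lt_d9]
        gcongr
        nlinarith
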